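/- **Definitions.** All sequences are real sequences indexed by $n\in\mathbb N$. Two eventually nonzero sequences $f,g$ lie in the same *Archimedean class* if there is $M>0$ with $|f_n|\le M|g_n|$ and $|g_n|\le M|f_n|$ for all large $n$. Classes are multiplied by multiplying members termwise, and the class of $f$ is *smaller* than the class of $g$ if $f_n/g_n\to 0$. The *infinite prototypes* are the sequences generated from the sequence $\omega=(n)$ by finitely many steps of the following kinds: the iterated logarithms $\ln\cdots\ln(\omega)$; $f\mapsto \exp(f)$; $f\mapsto f^{\alpha}$ with real $\alpha>0$; $(f,g)\mapsto fg$ if $f,g$ are in different classes; $(f,g)\mapsto f/g$ if the class of $g$ is smaller than that of $f$; the *feedback rule* $f\mapsto f^{1/t}$, where $t=d_1q_1+\dots+d_mq_m+d_0$ with real $d_i$ and infinite prototypes $q_1,\dots,q_m$ of strictly decreasing classes, $t_n>0$ for all large $n$, and for every integer $k$, $t_n^k<\ln f_n$ for all large $n$; and, optionally, the *cardinal jump rule*, which adjoins sequences standing for $\exp\exp\exp\cdots(f)$ and $\ln\ln\ln\cdots(f)$. These sequences may be chosen arbitrarily subject to the ordering that the rule prescribes: they tend to $+\infty$; the first is of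 larger class than every iterated exponential of $f$; the second is of smaller class than every iterated logarithm of $f$; and the classes of any two of the resulting infinite prototypes are comparable (equal, or one smaller than the other). If the cardinal jump rule is not used, nothing about comparability is assumed. A *prototype* is an infinite prototype, the inverse of one, or the constant sequence $1$. In each class that contains prototypes fix one of them, arbitrarily, as the typical member $p=(p_n)$ denoting that class. The *leading term limit* of a sequence $s$ is $cp$ if $c\in\mathbb R\setminus\{0\}$ and $s_n/p_n\to c$. A *limit* of $s$ is $0$ if $s$ is eventually zero, and otherwise is any finite sum $c_1p_1+\dots+c_kp_k$ ($k\ge 1$) such that $c_ip_i$ is the leading term limit of $s-c_1p_1-\dots-c_{i-1}p_{i-1}$ for each $i$. The sequence $s$ is *smooth* if this subtraction of leading terms either reaches an eventually zero sequence or can be continued forever. Limits $\sum_i c_ip_i$ are formal finite sums over Archimedean classes, added and multiplied by the distributive law using the multiplication of classes; $x<y$ if, at the largest class where the coefficients of $x$ and $y$ differ, the coefficient of $x$ is smaller. Let $\mathbb I_n$ be the set of quotients $\lim s/\lim t$, where $\lim s,\lim t$ are limits of smooth sequences and $\lim t\ne 0$, with $x/y$ and $x'/y'$ identified if $xy'=x'y$.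 **Theorem.** The identification is an equivalence relation (two quotients denote the same number if and only if $xy'=x'y$), every element of $\mathbb I_n$ can be written with positive denominator, and $\mathbb I_n$ is an ordered field, with well-defined operations and order given by $$\frac{x}{y}+\frac{x'}{y'}=\frac{xy'+x'y}{yy'},\qquad \frac{x}{y}\cdot\frac{x'}{y'}=\frac{xx'}{yy'},\qquad \frac{x}{y}<\frac{x'}{y'}\iff xy'<x'y\quad(y,y'>0),$$ the numerators and denominators on the right of the first two formulas being again limits of smooth sequences. -/

import Mathlib

open Filter Topology Asymptotics

/-! ### Archimedean classes of sequences -/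

/-- Real sequences. -/
abbrev RSeq : Type := ℕ → ℝ

/-- Sequences that are eventually nonzero. -/
def NonzeroSeq : Type := {f : RSeq // ∀ᶠ n in atTop, f n ≠ 0}

/-- Two sequences lie in the same Archimedean class when they agree in the symmetric big-O sense:
each one is eventually bounded by a positive constant times the other. -/
instance archSetoid : Setoid NonzeroSeq where
  r f g := f.1 =Θ[atTop] g.1
  iseqv := ⟨fun _ => isTheta_refl _ _, fun h => h.symm, fun h k => h.trans k⟩

/-- The nonzero Archimedean classes of sequences. -/
def ArchClass : Type := Quotient archSetoid

namespace ArchClass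

/-- The class `C` is the class of the sequence `f`. -/
def Contains (C : ArchClass) (f : RSeq) : Prop :=
  ∃ h : ∀ᶠ n in atTop, f n ≠ 0, C = Quotient.mk archSetoid ⟨f, h⟩

/-- Classes are multiplied by multiplying members term by term. -/
instance : Mul ArchClass where
  mul := Quotient.map₂
    (fun f g => ⟨fun n => f.1 n * g.1 n, by
      filter_upwards [f.2, g.2] with n h k using mul_ne_zero h k⟩)
    (fun _ _ h _ _ k => IsTheta.mul h k)

instance : One ArchClass where
  one := Quotient.mk archSetoid ⟨fun _ => 1, Eventually.of_forall fun _ => one_ne_zero⟩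

/-- Classes are inverted by inverting members term by term. -/
noncomputable instance : Inv ArchClass where
  inv := Quotient.map
    (fun f => ⟨fun n => (f.1 n)⁻¹, by filter_upwards [f.2] with n h using inv_ne_zero h⟩)
    (fun _ _ h => IsTheta.inv h)

theorem mk_eq_of_eventuallyEq {f g : NonzeroSeq} (h : f.1 =ᶠ[atTop] g.1) :
    Quotient.mk archSetoid f = Quotient.mk archSetoid g :=
  Quotient.sound (s := archSetoid) (show f.1 =Θ[atTop] g.1 from
    ⟨h.isBigO, h.symm.isBigO⟩)

noncomputable instance : CommGroup ArchClass where
  mul_assoc a b c := by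
    induction a using Quotient.inductionOn
    induction b using Quotient.inductionOn
    induction c using Quotient.inductionOn
    exact mk_eq_of_eventuallyEq (Eventually.of_forall fun n => mul_assoc _ _ _)
  one_mul a := by
    induction a using Quotient.inductionOn
    exact mk_eq_of_eventuallyEq (Eventually.of_forall fun n => one_mul _)
  mul_one a := by
    induction a using Quotient.inductionOn
    exact mk_eq_of_eventuallyEq (Eventually.of_forall fun n => mul_one _)
  inv_mul_cancel a := by
    induction a using Quotient.inductionOn with
    | h f =>
      refine mk_eq_of_eventuallyEq ?_
      filter_upwards [f.2] with n h using inv_mul_cancel₀ h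
  mul_comm a b := by
    induction a using Quotient.inductionOn
    induction b using Quotient.inductionOn
    exact mk_eq_of_eventuallyEq (Eventually.of_forall fun n => mul_comm _ _)

/-- `C` is a smaller class than `D`: the members of `C` are eventually below every positive
multiple of the members of `D`. -/
def Smaller : ArchClass → ArchClass → Prop :=
  Quotient.lift₂ (fun f g => f.1 =o[atTop] g.1) (fun _ _ _ _ h k =>
    propext ((IsTheta.isLittleO_congr_left h).trans (IsTheta.isLittleO_congr_right k)))

end ArchClass

/-! ### Prototypes -/

/-- An interpretation of the symbols `exp exp exp …` and `ln ln ln …`: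
`expOmega f g` says that the sequence `g` stands for `exp exp exp … (f)`, and
`lnOmega f g` says that the sequence `g` stands for `ln ln ln … (f)`. -/
structure CardinalJump where
  expOmega : RSeq → RSeq → Prop
  lnOmega : RSeq → RSeq → Prop

/-- No use is made of the cardinal jump rule. -/
def CardinalJump.none : CardinalJump where
  expOmega _ _ := False
  lnOmega _ _ := False

/-- The sequences that are prototypes of infinite Archimedean classes, the symbols of the
cardinal jump rule being interpreted by `J`. -/
inductive InfProto (J : CardinalJump) : RSeq → Prop
  /-- The sequence `n`, and its iterated logarithms. -/
  | iterLog (k : ℕ) : InfProto J (fun n => Real.log^[k] (n : ℝ))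
  | exp (f : RSeq) (hf : InfProto J f) : InfProto J (fun n => Real.exp (f n))
  | pow (f : RSeq) (α : ℝ) (hα : 0 < α) (hf : InfProto J f) : InfProto J (fun n => f n ^ α)
  /-- The product of two unequal classes. -/
  | mul (f g : RSeq) (hf : InfProto J f) (hg : InfProto J g) (hfg : ¬ f =Θ[atTop] g) :
      InfProto J (fun n => f n * g n)
  /-- The quotient of a larger class by a smaller one. -/
  | div (f g : RSeq) (hf : InfProto J f) (hg : InfProto J g) (hgf : g =o[atTop] f) :
      InfProto J (fun n => f n / g n)
  | expOmega (f g : RSeq) (hf : InfProto J f) (hg : J.expOmega f g) : InfProto J g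
  | lnOmega (f g : RSeq) (hf : InfProto J f) (hg : J.lnOmega f g) : InfProto J g
  /-- The feedback rule: `f ^ (1 / lim t)`, where `lim t = d₁ q₁ + ⋯ + d_m q_m + d₀` is positive,
  has no infinitesimal terms (`q₁ > ⋯ > q_m` are infinite prototypes),
  and satisfies `(lim t) ^ k < ln f` for all integers `k`. -/
  | feedback (f : RSeq) (hf : InfProto J f) (m : ℕ) (q : Fin m → RSeq)
      (hq : ∀ i, InfProto J (q i)) (hdecr : ∀ i j, i < j → q j =o[atTop] q i)
      (d : Fin m → ℝ) (d₀ : ℝ) (t : RSeq) (ht : ∀ n, t n = (∑ i, d i * q i n) + d₀)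
      (hpos : ∀ᶠ n in atTop, 0 < t n)
      (hlog : ∀ k : ℤ, ∀ᶠ n in atTop, t n ^ k < Real.log (f n)) :
      InfProto J (fun n => f n ^ (1 / t n))

/-- The ordering that the cardinal jump rule prescribes: `exp exp exp … (f)` is infinite and
exceeds all iterated exponentials of `f`, `ln ln ln … (f)` is infinite and below all
iterated logarithms of `f`, and the infinite Archimedean classes that result are linearly
ordered. -/
structure CardinalJump.Lawful (J : CardinalJump) : Prop where
  expOmega_infinite : ∀ f g, InfProto J f → J.expOmega f g → Tendsto g atTop atTop
  expOmega_large : ∀ f g, InfProto J f → J.expOmega f g →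
    ∀ k : ℕ, (fun n => Real.exp^[k] (f n)) =o[atTop] g
  lnOmega_infinite : ∀ f g, InfProto J f → J.lnOmega f g → Tendsto g atTop atTop
  lnOmega_small : ∀ f g, InfProto J f → J.lnOmega f g →
    ∀ k : ℕ, g =o[atTop] (fun n => Real.log^[k] (f n))
  ordered : ∀ f g, InfProto J f → InfProto J g →
    f =o[atTop] g ∨ f =Θ[atTop] g ∨ g =o[atTop] f

/-- Prototypes of nonzero classes: infinite ones, their inverses, and `1`. -/
def Proto (J : CardinalJump) (p : RSeq) : Prop :=
  InfProto J p ∨ (∃ f, InfProto J f ∧ p = fun n => (f n)⁻¹) ∨ p = fun _ => 1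

/-- The nonzero Archimedean classes that have a prototype. -/
def protoClasses (J : CardinalJump) : Set ArchClass := {C | ∃ p, Proto J p ∧ C.Contains p}

/-- `rep` picks a typical member out of each class that has a prototype:
a prototype sequence that denotes the class. -/
def IsTypicalChoice (J : CardinalJump) (rep : ArchClass → RSeq) : Prop :=
  ∀ C ∈ protoClasses J, Proto J (rep C) ∧ C.Contains (rep C)

/-! ### Limits of smooth sequences -/

/-- Finite sums `∑ cᵢ pᵢ` with real coefficients, prototypes being identified with their
Archimedean classes. They are added and multiplied out in the usual way. -/
abbrev FormalSum : Type := MonoidAlgebra ℝ ArchClass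

section Limits

variable (J : CardinalJump) (rep : ArchClass → RSeq)

/-- The leading term limit of `s` is `c p`, where `p` is the prototype of the class `C`. -/
def LeadingTerm (s : RSeq) (c : ℝ) (C : ArchClass) : Prop :=
  c ≠ 0 ∧ C ∈ protoClasses J ∧ Tendsto (fun n => s n / rep C n) atTop (𝓝 c)

/-- `L` is the limit of `s`, taken as far as one wants: it is `0` if `s` is eventually zero, and
otherwise the sum of finitely many successive terms, each one the leading term
limit of what remains of `s` once the earlier terms have been subtracted. -/
inductive HasLimit : RSeq → FormalSum → Prop
  | zero (s : RSeq) (hs : ∀ᶠ n in atTop, s n = 0) : HasLimit s 0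
  | last (s : RSeq) (c : ℝ) (C : ArchClass) (h : LeadingTerm J rep s c C) :
      HasLimit s (MonoidAlgebra.single C c)
  | next (s : RSeq) (c : ℝ) (C : ArchClass) (h : LeadingTerm J rep s c C) (L : FormalSum)
      (hL : HasLimit (fun n => s n - c * rep C n) L) :
      HasLimit s (MonoidAlgebra.single C c + L)

/-- `s` is smooth: the process of subtracting leading terms never gets stuck, that is, it
ends with an eventually zero sequence or can be continued forever. -/
def Smooth (s : RSeq) : Prop :=
  ∃ S : Set RSeq, s ∈ S ∧ ∀ u ∈ S, (∀ᶠ n in atTop, u n = 0) ∨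
    ∃ c C, LeadingTerm J rep u c C ∧ (fun n => u n - c * rep C n) ∈ S

/-- `L` is the limit of a smooth sequence. -/
def IsSmoothLimit (L : FormalSum) : Prop := ∃ s, Smooth J rep s ∧ HasLimit J rep s L

/-- Limits are ordered by the first term in which they differ: `x < y` if the coefficient of
`x` is smaller than that of `y` at the largest class at which these coefficients differ. -/
def LimitLT (x y : FormalSum) : Prop :=
  ∃ C, x.coeff C < y.coeff C ∧ ∀ D, C.Smaller D → x.coeff D = y.coeff D

/-- An expression `lim s / lim t` with `s` and `t` smooth and `lim t ≠ 0`. -/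
structure LimitQuotient where
  num : FormalSum
  den : FormalSum
  num_isSmoothLimit : IsSmoothLimit J rep num
  den_isSmoothLimit : IsSmoothLimit J rep den
  den_ne_zero : den ≠ 0

/-- The set `𝕀ₙ` of the numbers `lim s / lim t`, quotients being identified when
cross-multiplication identifies them. -/
def InfiniteNumbers : Type :=
  Quot fun a b : LimitQuotient J rep => a.num * b.den = b.num * a.den

/-- The number denoted by an expression `lim s / lim t`. -/
def LimitQuotient.value (a : LimitQuotient J rep) : InfiniteNumbers J rep := Quot.mk _ a

end Limits

/-!
A limit of a smooth sequence is nothing but a formal sum over Archimedean classes that have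
prototypes: any such sum is the limit of the corresponding linear combination of typical members,
from which its leading terms are peeled off until nothing is left (`isSmoothLimit_iff`). So the
theorem is one about the real group algebra of the set of these classes. Once this set is known to
be a linearly ordered group, the group algebra embeds into the field of Hahn series with real
coefficients, and the order of limits by the first differing term becomes the order of that field
(`limitLT_iff`). Quotients of limits are then the elements of a subfield of an ordered field, and
cross-multiplication is equality in it.

The closure of the prototype classes under multiplication and their linear order both rest on the
comparability of infinite prototypes. With the cardinal jump rule, this is part of what the rule
prescribes. Without it, this is a theorem of Hardy (`CardinalJump.lawful_none`), proved here as
follows. A Hardy ring is an algebra of real functions that has derivatives and in which each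
function has eventually a constant sign. By Zorn's lemma there is a maximal one. It contains
the quotients of its members, and also their exponentials and primitives: for a polynomial in
`exp f` or in a primitive, after division by a coefficient, the derivative is simpler, hence has
eventually a constant sign by induction, so that the polynomial is eventually monotone and has
eventually a constant sign as well (`IsHardy.eventuallySigned_exp`,
`IsHardy.eventuallySigned_primitive`). So all prototypes are restrictions of functions in a
maximal Hardy ring, and two positive members `F` and `G` of it are comparable because every
difference `F - c G` has eventually a constant sign.
-/

/-! ### Hardy rings -/

/-- The function is eventually zero, eventually positive or eventually negative. -/
def EventuallySigned (f : ℝ → ℝ) : Prop :=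
  (∀ᶠ x in atTop, f x = 0) ∨ (∀ᶠ x in atTop, 0 < f x) ∨ ∀ᶠ x in atTop, f x < 0

/-- A Hardy ring: an algebra of real functions, each of which has eventually a derivative in the
algebra and eventually a constant sign. Functions are not identified when they are eventually
equal, so that no germs are needed. -/
structure IsHardy (R : Subalgebra ℝ (ℝ → ℝ)) : Prop where
  deriv : ∀ f ∈ R, ∃ f' ∈ R, ∀ᶠ x in atTop, HasDerivAt f (f' x) x
  sign : ∀ f ∈ R, EventuallySigned f

namespace EventuallySigned

theorem congr {f g : ℝ → ℝ} (hf : EventuallySigned f) (h : ∀ᶠ x in atTop, g x = f x) :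
    EventuallySigned g := by
  rcases hf with h0 | h0 | h0
  · left; filter_upwards [h, h0] with x a b; rw [a, b]
  · right; left; filter_upwards [h, h0] with x a b; rw [a]; exact b
  · right; right; filter_upwards [h, h0] with x a b; rw [a]; exact b

theorem neg {f : ℝ → ℝ} (hf : EventuallySigned f) : EventuallySigned (fun x => -f x) := by
  rcases hf with h0 | h0 | h0
  · left; filter_upwards [h0] with x a; simp [a]
  · right; right; filter_upwards [h0] with x a; linarith
  · right; left; filter_upwards [h0] with x a; linarith

theorem mul {f g : ℝ → ℝ} (hf : EventuallySigned f) (hg : EventuallySigned g) :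
    EventuallySigned (fun x => f x * g x) := by
  rcases hf with h | h | h
  · left; filter_upwards [h] with x a; simp [a]
  · rcases hg with k | k | k
    · left; filter_upwards [k] with x a; simp [a]
    · right; left; filter_upwards [h, k] with x a b; exact mul_pos a b
    · right; right; filter_upwards [h, k] with x a b; exact mul_neg_of_pos_of_neg a b
  · rcases hg with k | k | k
    · left; filter_upwards [k] with x a; simp [a]
    · right; right; filter_upwards [h, k] with x a b; exact mul_neg_of_neg_of_pos a b
    · right; left; filter_upwards [h, k] with x a b; exact mul_pos_of_neg_of_neg a b

theorem const (c : ℝ) : EventuallySigned (fun _ => c) := by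
  rcases lt_trichotomy c 0 with h | h | h
  · exact .inr (.inr (.of_forall fun _ => h))
  · exact .inl (.of_forall fun _ => h)
  · exact .inr (.inl (.of_forall fun _ => h))

theorem eventually_zero_or_ne {f : ℝ → ℝ} (hf : EventuallySigned f) :
    (∀ᶠ x in atTop, f x = 0) ∨ ∀ᶠ x in atTop, f x ≠ 0 := by
  rcases hf with h | h | h
  · exact .inl h
  · exact .inr (h.mono fun _ => ne_of_gt)
  · exact .inr (h.mono fun _ => ne_of_lt)

/-- A function that is eventually strictly increasing is eventually negative, unless it reaches a
value that is nonnegative; it is positive from there on. -/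
theorem of_deriv_pos {f f' : ℝ → ℝ} (hd : ∀ᶠ x in atTop, HasDerivAt f (f' x) x)
    (hf : ∀ᶠ x in atTop, 0 < f' x) : EventuallySigned f := by
  obtain ⟨a, ha⟩ := eventually_atTop.1 (hd.and hf)
  have hm : StrictMonoOn f (Set.Ici a) := by
    refine strictMonoOn_of_deriv_pos (convex_Ici a)
      (fun x hx => (ha x hx).1.continuousAt.continuousWithinAt) fun x hx => ?_
    rw [interior_Ici] at hx
    have := ha x hx.le
    rw [this.1.deriv]; exact this.2
  by_cases h : ∃ b, a ≤ b ∧ 0 ≤ f b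
  · obtain ⟨b, hab, hb⟩ := h
    right; left
    filter_upwards [eventually_gt_atTop b] with x hx
    exact hb.trans_lt (hm hab (hab.trans hx.le) hx)
  · push Not at h
    right; right
    filter_upwards [eventually_ge_atTop a] with x hx using h x hx

/-- A function whose derivative has eventually a constant sign has one itself, since it is
eventually strictly monotone or eventually constant. -/
theorem of_deriv {f f' : ℝ → ℝ} (hd : ∀ᶠ x in atTop, HasDerivAt f (f' x) x)
    (hf : EventuallySigned f') : EventuallySigned f := by
  rcases hf with hf | hf | hf
  · obtain ⟨a, ha⟩ := eventually_atTop.1 (hd.and hf)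
    have hc : ∀ x, a ≤ x → f x = f a := by
      intro x hx
      refine constant_of_has_deriv_right_zero
        (fun y hy => (ha y hy.1).1.continuousAt.continuousWithinAt) (fun y hy => ?_) x
        (Set.right_mem_Icc.2 hx)
      have := ha y hy.1
      rw [← this.2]
      exact this.1.hasDerivWithinAt
    exact (const (f a)).congr ((eventually_ge_atTop a).mono hc)
  · exact of_deriv_pos hd hf
  · have h := of_deriv_pos (f := fun x => -f x) (f' := fun x => -f' x)
      (hd.mono fun x hx => hx.neg) (hf.mono fun x hx => by linarith)
    exact h.neg.congr (.of_forall fun x => by simp)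

end EventuallySigned

theorem Filter.Eventually.eventually_nhds_atTop {p : ℝ → Prop} (h : ∀ᶠ x in atTop, p x) :
    ∀ᶠ x in atTop, ∀ᶠ y in 𝓝 x, p y := by
  obtain ⟨a, ha⟩ := eventually_atTop.1 h
  filter_upwards [eventually_gt_atTop a] with x hx
  exact (lt_mem_nhds hx).mono fun y hy => ha y hy.le

namespace IsHardy

variable {R : Subalgebra ℝ (ℝ → ℝ)}

theorem const_mem (R : Subalgebra ℝ (ℝ → ℝ)) (c : ℝ) : (fun _ => c) ∈ R := R.algebraMap_mem c

theorem bot : IsHardy ⊥ where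
  deriv f hf := by
    obtain ⟨c, rfl⟩ := Algebra.mem_bot.1 hf
    exact ⟨0, zero_mem _, .of_forall fun x => hasDerivAt_const x c⟩
  sign f hf := by
    obtain ⟨c, rfl⟩ := Algebra.mem_bot.1 hf
    exact .const c

/-- Every Hardy ring is contained in a maximal one. -/
theorem exists_maximal : ∃ R, Maximal IsHardy R := by
  obtain ⟨R, -, hR⟩ := zorn_le_nonempty₀ {R | IsHardy R} (fun c hc hch S hS => by
    refine ⟨sSup c, ?_, fun z hz => le_sSup hz⟩
    have hm : ∀ f, f ∈ sSup c ↔ ∃ T ∈ c, f ∈ T := fun f => by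
      have : Nonempty c := ⟨⟨S, hS⟩⟩
      rw [sSup_eq_iSup', ← SetLike.mem_coe,
        Subalgebra.coe_iSup_of_directed hch.directedOn.directed_val]
      simp
    constructor
    · intro f hf
      obtain ⟨T, hT, hf⟩ := (hm f).1 hf
      obtain ⟨f', h, h'⟩ := (hc hT).deriv f hf
      exact ⟨f', (hm f').2 ⟨T, hT, h⟩, h'⟩
    · intro f hf
      obtain ⟨T, hT, hf⟩ := (hm f).1 hf
      exact (hc hT).sign f hf) ⊥ bot
  exact ⟨R, hR⟩

/-! ### Quotients -/

/-- The functions that are eventually quotients of members of `R` with nonzero denominators. They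
include all functions that are eventually equal to a member of `R`. -/
def fractions (R : Subalgebra ℝ (ℝ → ℝ)) : Subalgebra ℝ (ℝ → ℝ) where
  carrier := {h | ∃ a ∈ R, ∃ b ∈ R, ∀ᶠ x in atTop, b x ≠ 0 ∧ h x = a x / b x}
  algebraMap_mem' c := ⟨_, R.algebraMap_mem c, 1, one_mem R, .of_forall fun x => by simp⟩
  add_mem' := by
    rintro f g ⟨a, ha, b, hb, h⟩ ⟨a', ha', b', hb', h'⟩
    refine ⟨a * b' + b * a', add_mem (mul_mem ha hb') (mul_mem hb ha'), b * b', mul_mem hb hb', ?_⟩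
    filter_upwards [h, h'] with x hx hx'
    exact ⟨mul_ne_zero hx.1 hx'.1, by
      simp only [Pi.add_apply, Pi.mul_apply, hx.2, hx'.2, div_add_div _ _ hx.1 hx'.1]⟩
  mul_mem' := by
    rintro f g ⟨a, ha, b, hb, h⟩ ⟨a', ha', b', hb', h'⟩
    refine ⟨a * a', mul_mem ha ha', b * b', mul_mem hb hb', ?_⟩
    filter_upwards [h, h'] with x hx hx'
    exact ⟨mul_ne_zero hx.1 hx'.1, by simp only [Pi.mul_apply, hx.2, hx'.2, div_mul_div_comm]⟩

theorem le_fractions (R : Subalgebra ℝ (ℝ → ℝ)) : R ≤ fractions R :=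
  fun f hf => ⟨f, hf, 1, one_mem R, .of_forall fun x => by simp⟩

theorem isHardy_fractions (hR : IsHardy R) : IsHardy (fractions R) where
  deriv := by
    rintro f ⟨a, ha, b, hb, h⟩
    obtain ⟨a', ha', da⟩ := hR.deriv a ha
    obtain ⟨b', hb', db⟩ := hR.deriv b hb
    refine ⟨fun x => (a' x * b x - a x * b' x) / b x ^ 2,
      ⟨a' * b - a * b', sub_mem (mul_mem ha' hb) (mul_mem ha hb'), b ^ 2, pow_mem hb 2, ?_⟩, ?_⟩
    · filter_upwards [h] with x hx using ⟨pow_ne_zero 2 hx.1, rfl⟩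
    · filter_upwards [h, h.eventually_nhds_atTop, da, db] with x hx hx' da db
      exact (da.fun_div db hx.1).congr_of_eventuallyEq (hx'.mono fun _ h => h.2)
  sign := by
    rintro f ⟨a, ha, b, hb, h⟩
    -- The quotient has the sign of the product `a * b`.
    rcases (hR.sign a ha).mul (hR.sign b hb) with k | k | k
    · left; filter_upwards [h, k] with x hx kx
      rw [hx.2, div_eq_zero_iff]; exact mul_eq_zero.1 kx
    · right; left; filter_upwards [h, k] with x hx kx
      rw [hx.2]; exact div_pos_iff.2 (mul_pos_iff.1 kx)
    · right; right; filter_upwards [h, k] with x hx kx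
      rw [hx.2]; exact div_neg_iff.2 (mul_neg_iff.1 kx)

section Maximal

variable (hR : Maximal IsHardy R)
include hR

theorem mem_of_div {a b f : ℝ → ℝ} (ha : a ∈ R) (hb : b ∈ R)
    (h : ∀ᶠ x in atTop, b x ≠ 0 ∧ f x = a x / b x) : f ∈ R :=
  hR.2 (isHardy_fractions hR.1) (le_fractions R) ⟨a, ha, b, hb, h⟩

theorem mem_of_eventuallyEq {f g : ℝ → ℝ} (hf : f ∈ R) (h : ∀ᶠ x in atTop, g x = f x) : g ∈ R :=
  mem_of_div hR hf (one_mem R) (h.mono fun x hx => by simp [hx])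

theorem div_mem {f g : ℝ → ℝ} (hf : f ∈ R) (hg : g ∈ R) : (fun x => f x / g x) ∈ R := by
  rcases (hR.1.sign g hg).eventually_zero_or_ne with h | h
  · exact mem_of_eventuallyEq hR (zero_mem R) (h.mono fun x hx => by simp [hx])
  · exact mem_of_div hR hf hg (h.mono fun x hx => ⟨hx, rfl⟩)

end Maximal

/-! ### Exponentials and primitives -/

/-- Adjoining `y` to a Hardy ring gives a Hardy ring if `y` has a derivative in the new ring and
the polynomials in `y` have eventually a constant sign. -/
theorem adjoin (hR : IsHardy R) {y y' : ℝ → ℝ} (hy' : y' ∈ Algebra.adjoin R {y})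
    (hd : ∀ᶠ x in atTop, HasDerivAt y (y' x) x)
    (hs : ∀ (n : ℕ) (a : ℕ → ℝ → ℝ), (∀ i, a i ∈ R) →
      EventuallySigned fun x => ∑ i ∈ Finset.range n, a i x * y x ^ i) :
    IsHardy ((Algebra.adjoin R {y}).restrictScalars ℝ) where
  deriv := by
    suffices h : ∀ f ∈ Algebra.adjoin R {y}, ∃ f' ∈ Algebra.adjoin R {y},
        ∀ᶠ x in atTop, HasDerivAt f (f' x) x from h
    intro f hf
    induction hf using Algebra.adjoin_induction with
    | mem f hf =>
      rw [Set.mem_singleton_iff.1 hf]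
      exact ⟨y', hy', hd⟩
    | algebraMap r =>
      obtain ⟨r', h, h'⟩ := hR.deriv r r.2
      exact ⟨r', (Algebra.adjoin R {y}).algebraMap_mem ⟨r', h⟩, h'⟩
    | add f g hf hg ihf ihg =>
      obtain ⟨f', hf', df⟩ := ihf
      obtain ⟨g', hg', dg⟩ := ihg
      exact ⟨f' + g', add_mem hf' hg', df.and dg |>.mono fun x h => h.1.add h.2⟩
    | mul f g hf hg ihf ihg =>
      obtain ⟨f', hf', df⟩ := ihf
      obtain ⟨g', hg', dg⟩ := ihg
      exact ⟨f' * g + f * g', add_mem (mul_mem hf' hg) (mul_mem hf hg'),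
        df.and dg |>.mono fun x h => h.1.mul h.2⟩
  sign f hf := by
    have hf : f ∈ Algebra.adjoin R {y} := hf
    rw [Algebra.adjoin_singleton_eq_range_aeval] at hf
    obtain ⟨p, rfl⟩ := hf
    refine (hs (p.natDegree + 1) (fun i => p.coeff i) fun i => (p.coeff i).2).congr
      (.of_forall fun x => ?_)
    change Polynomial.aeval y p x = _
    rw [Polynomial.aeval_eq_sum_range]
    simp [Algebra.smul_def]

theorem mem_adjoin_coe {y f : ℝ → ℝ} (hf : f ∈ R) : f ∈ Algebra.adjoin R {y} :=
  (Algebra.adjoin R {y}).algebraMap_mem ⟨f, hf⟩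

section Maximal

variable (hR : Maximal IsHardy R)
include hR

theorem mem_of_isHardy_adjoin {y : ℝ → ℝ}
    (h : IsHardy ((Algebra.adjoin R {y}).restrictScalars ℝ)) : y ∈ R :=
  hR.2 h (fun _ hf => mem_adjoin_coe hf) (Algebra.self_mem_adjoin_singleton _ y)

/-- Dividing a polynomial in `exp f` by its constant term and differentiating leaves `exp f` times
a polynomial of smaller degree. -/
theorem eventuallySigned_exp {f f' : ℝ → ℝ} (hf' : f' ∈ R)
    (hd : ∀ᶠ x in atTop, HasDerivAt f (f' x) x) (n : ℕ) : ∀ a : ℕ → ℝ → ℝ, (∀ i, a i ∈ R) →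
      EventuallySigned fun x => ∑ i ∈ Finset.range n, a i x * Real.exp (f x) ^ i := by
  induction n with
  | zero => intro a _; simpa using EventuallySigned.const 0
  | succ n ih =>
    intro a ha
    have hexp : EventuallySigned fun x => Real.exp (f x) :=
      .inr (.inl (.of_forall fun x => Real.exp_pos _))
    rcases (hR.1.sign _ (ha 0)).eventually_zero_or_ne with h0 | h0
    · refine (hexp.mul (ih (fun i => a (i + 1)) fun i => ha _)).congr (h0.mono fun x hx => ?_)
      rw [Finset.sum_range_succ', hx, Finset.mul_sum]
      simp only [zero_mul, add_zero]
      exact Finset.sum_congr rfl fun i _ => by ring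
    · have hc : ∀ i, (fun x => a (i + 1) x / a 0 x) ∈ R := fun i => div_mem hR (ha _) (ha 0)
      choose c' hc' dc using fun i => hR.1.deriv _ (hc i)
      have h1 : EventuallySigned fun x =>
          ∑ i ∈ Finset.range n, a (i + 1) x / a 0 x * Real.exp (f x) ^ (i + 1) + 1 := by
        refine .of_deriv (f' := fun x => Real.exp (f x) * ∑ i ∈ Finset.range n,
          (c' i x + (i + 1) * f' x * (a (i + 1) x / a 0 x)) * Real.exp (f x) ^ i) ?_
          (hexp.mul (ih (fun i => c' i + (fun _ => (i : ℝ) + 1) * f' *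
            fun x => a (i + 1) x / a 0 x) fun i => add_mem (hc' i)
              (mul_mem (mul_mem (const_mem R _) hf') (hc i))))
        filter_upwards [hd, eventually_all.2 fun i : Fin n => dc i] with x hx hcx
        rw [Finset.mul_sum]
        refine (HasDerivAt.fun_sum fun i hi => ?_).add_const 1
        refine ((hcx ⟨i, Finset.mem_range.1 hi⟩).mul (hx.exp.pow (i + 1))).congr_deriv ?_
        simp only [Pi.pow_apply, Nat.add_sub_cancel]
        push_cast
        ring
      refine ((hR.1.sign _ (ha 0)).mul h1).congr (h0.mono fun x hx => ?_)
      rw [Finset.sum_range_succ', mul_add, Finset.mul_sum]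
      simp only [pow_zero]
      congr 1
      exact Finset.sum_congr rfl fun i _ => by field_simp

theorem exp_mem {f : ℝ → ℝ} (hf : f ∈ R) : (fun x => Real.exp (f x)) ∈ R := by
  obtain ⟨f', hf', hd⟩ := hR.1.deriv f hf
  refine mem_of_isHardy_adjoin hR (hR.1.adjoin (y' := (fun x => Real.exp (f x)) * f')
    (mul_mem (Algebra.self_mem_adjoin_singleton _ _) (mem_adjoin_coe hf'))
    (hd.mono fun x hx => hx.exp) (eventuallySigned_exp hR hf' hd))

/-- Dividing a polynomial in a primitive `y` of a member of `R` by its leading coefficient and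
differentiating leaves a polynomial of smaller degree. -/
theorem eventuallySigned_primitive {y y' : ℝ → ℝ} (hy' : y' ∈ R)
    (hd : ∀ᶠ x in atTop, HasDerivAt y (y' x) x) (n : ℕ) : ∀ a : ℕ → ℝ → ℝ, (∀ i, a i ∈ R) →
      EventuallySigned fun x => ∑ i ∈ Finset.range n, a i x * y x ^ i := by
  induction n with
  | zero => intro a _; simpa using EventuallySigned.const 0
  | succ n ih =>
    intro a ha
    rcases (hR.1.sign _ (ha n)).eventually_zero_or_ne with h0 | h0
    · refine (ih a ha).congr (h0.mono fun x hx => ?_)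
      rw [Finset.sum_range_succ, hx, zero_mul, add_zero]
    · have hc : ∀ i, (fun x => a i x / a n x) ∈ R := fun i => div_mem hR (ha _) (ha n)
      choose c' hc' dc using fun i => hR.1.deriv _ (hc i)
      have h1 : EventuallySigned fun x =>
          ∑ i ∈ Finset.range n, a i x / a n x * y x ^ i + y x ^ n := by
        refine .of_deriv (f' := fun x => ∑ i ∈ Finset.range n,
          (c' i x + (i + 1) * y' x * (a (i + 1) x / a n x)) * y x ^ i) ?_
          (ih (fun i => c' i + (fun _ => (i : ℝ) + 1) * y' *
            fun x => a (i + 1) x / a n x) fun i => add_mem (hc' i)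
              (mul_mem (mul_mem (const_mem R _) hy') (hc (i + 1))))
        filter_upwards [hd, h0, eventually_all.2 fun i : Fin n => dc i] with x hx h0 hcx
        have key := (HasDerivAt.fun_sum (u := Finset.range n)
          (A := fun i z => a i z / a n z * y z ^ i)
          (A' := fun i => c' i x * y x ^ i + a i x / a n x * (i * y x ^ (i - 1) * y' x))
          fun i hi => (hcx ⟨i, Finset.mem_range.1 hi⟩).mul (hx.pow i)).add (hx.pow n)
        refine key.congr_deriv ?_
        -- The terms that come from differentiating the powers of `y` are shifted by one.
        have e : ∑ i ∈ Finset.range n, (i + 1) * y' x * (a (i + 1) x / a n x) * y x ^ i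
            = ∑ i ∈ Finset.range (n + 1), a i x / a n x * (i * y x ^ (i - 1) * y' x) := by
          rw [Finset.sum_range_succ']
          simp only [CharP.cast_eq_zero, zero_mul, mul_zero, add_zero, Nat.add_sub_cancel]
          refine Finset.sum_congr rfl fun i _ => ?_
          push_cast
          ring
        simp only [add_mul, Finset.sum_add_distrib] at e ⊢
        rw [e, Finset.sum_range_succ, div_self h0]
        ring
      refine ((hR.1.sign _ (ha n)).mul h1).congr (h0.mono fun x hx => ?_)
      rw [Finset.sum_range_succ, mul_add, Finset.mul_sum]
      congr 1
      exact Finset.sum_congr rfl fun i _ => by field_simp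

theorem primitive_mem {y y' : ℝ → ℝ} (hy' : y' ∈ R)
    (hd : ∀ᶠ x in atTop, HasDerivAt y (y' x) x) : y ∈ R :=
  mem_of_isHardy_adjoin hR (hR.1.adjoin (mem_adjoin_coe hy') hd
    (eventuallySigned_primitive hR hy' hd))

theorem id_mem : (fun x => x) ∈ R :=
  primitive_mem hR (one_mem R) (.of_forall fun x => hasDerivAt_id x)

theorem log_mem {f : ℝ → ℝ} (hf : f ∈ R) (h : ∀ᶠ x in atTop, 0 < f x) :
    (fun x => Real.log (f x)) ∈ R := by
  obtain ⟨f', hf', hd⟩ := hR.1.deriv f hf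
  exact primitive_mem hR (div_mem hR hf' hf) (hd.and h |>.mono fun x hx => hx.1.log hx.2.ne')

theorem rpow_mem {f g : ℝ → ℝ} (hf : f ∈ R) (h : ∀ᶠ x in atTop, 0 < f x) (hg : g ∈ R) :
    (fun x => f x ^ g x) ∈ R :=
  mem_of_eventuallyEq hR (exp_mem hR (mul_mem (log_mem hR hf h) hg))
    (h.mono fun _ hx => Real.rpow_def_of_pos hx _)

end Maximal

end IsHardy

/-! ### Infinite prototypes -/

/-- All infinite prototypes tend to infinity if those of the cardinal jump rule do. -/
theorem InfProto.tendsto_atTop {J : CardinalJump}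
    (hexp : ∀ f g, InfProto J f → J.expOmega f g → Tendsto g atTop atTop)
    (hln : ∀ f g, InfProto J f → J.lnOmega f g → Tendsto g atTop atTop)
    {f : RSeq} (hf : InfProto J f) : Tendsto f atTop atTop := by
  induction hf with
  | iterLog k =>
    induction k with
    | zero => exact tendsto_natCast_atTop_atTop
    | succ k ih =>
      simp only [Function.iterate_succ_apply']
      exact Real.tendsto_log_atTop.comp ih
  | exp f _ ih => exact Real.tendsto_exp_atTop.comp ih
  | pow f α hα _ ih => exact (tendsto_rpow_atTop hα).comp ih
  | mul f g _ _ _ ihf ihg => exact ihf.atTop_mul_atTop₀ ihg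
  | div f g _ _ hgf ihf ihg =>
    have h0 : Tendsto (fun n => g n / f n) atTop (𝓝[>] 0) := by
      refine tendsto_nhdsWithin_iff.2 ⟨hgf.tendsto_div_nhds_zero, ?_⟩
      filter_upwards [ihf.eventually_gt_atTop 0, ihg.eventually_gt_atTop 0] with n h k
      exact div_pos k h
    exact h0.inv_tendsto_nhdsGT_zero.congr fun n => by simp
  | expOmega f g hf hg _ => exact hexp f g hf hg
  | lnOmega f g hf hg _ => exact hln f g hf hg
  | feedback f _ m q _ _ d d₀ t _ hpos hlog ih _ =>
    have hl : Tendsto (fun n => Real.log (f n)) atTop atTop := Real.tendsto_log_atTop.comp ih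
    -- Since `t ^ 2 < log f`, the exponent `log f / t` exceeds `√(log f)`.
    have hs : Tendsto (fun n => Real.log (f n) * (1 / t n)) atTop atTop := by
      refine tendsto_atTop_mono' _ ?_ (Real.tendsto_sqrt_atTop.comp hl)
      filter_upwards [hpos, hlog 2, hl.eventually_gt_atTop 0] with n ht h2 h0
      have h2 : t n ≤ √(Real.log (f n)) := Real.le_sqrt_of_sq_le (by exact_mod_cast h2.le)
      rw [mul_one_div, Function.comp_apply, le_div_iff₀ ht]
      calc √(Real.log (f n)) * t n ≤ √(Real.log (f n)) * √(Real.log (f n)) := by gcongr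
        _ = Real.log (f n) := Real.mul_self_sqrt h0.le
    refine (Real.tendsto_exp_atTop.comp hs).congr' ?_
    filter_upwards [ih.eventually_gt_atTop 0] with n h
    exact (Real.rpow_def_of_pos h _).symm

theorem InfProto.tendsto_atTop_of_none {f : RSeq} (hf : InfProto .none f) :
    Tendsto f atTop atTop :=
  hf.tendsto_atTop (fun _ _ _ => False.elim) (fun _ _ _ => False.elim)

theorem InfProto.tendsto_atTop_of_lawful {J : CardinalJump} (hJ : J.Lawful) {f : RSeq}
    (hf : InfProto J f) : Tendsto f atTop atTop :=
  hf.tendsto_atTop hJ.expOmega_infinite hJ.lnOmega_infinite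

namespace IsHardy

variable {R : Subalgebra ℝ (ℝ → ℝ)}

theorem eventually_pos_of_tendsto (hR : IsHardy R) {F : ℝ → ℝ} (hF : F ∈ R) {f : RSeq}
    (h : ∀ᶠ n : ℕ in atTop, f n = F n) (hf : Tendsto f atTop atTop) :
    ∀ᶠ x in atTop, 0 < F x := by
  have hp := h.and (hf.eventually_gt_atTop 0)
  rcases hR.sign F hF with k | k | k
  · obtain ⟨n, hn, hn'⟩ := (hp.and (tendsto_natCast_atTop_atTop.eventually k)).exists
    linarith [hn.1, hn.2]
  · exact k
  · obtain ⟨n, hn, hn'⟩ := (hp.and (tendsto_natCast_atTop_atTop.eventually k)).exists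
    linarith [hn.1, hn.2]

/-- Without the cardinal jump rule, the infinite prototypes are restrictions of members of any
maximal Hardy ring. -/
theorem exists_mem_of_infProto (hR : Maximal IsHardy R) {f : RSeq} (hf : InfProto .none f) :
    ∃ F ∈ R, ∀ᶠ n : ℕ in atTop, f n = F n := by
  induction hf with
  | iterLog k =>
    induction k with
    | zero => exact ⟨_, id_mem hR, .of_forall fun n => rfl⟩
    | succ k ih =>
      obtain ⟨F, hF, h⟩ := ih
      refine ⟨_, log_mem hR hF (hR.1.eventually_pos_of_tendsto hF h
        (InfProto.iterLog k).tendsto_atTop_of_none), h.mono fun n hn => ?_⟩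
      simp only [Function.iterate_succ_apply', hn]
  | exp f _ ih =>
    obtain ⟨F, hF, h⟩ := ih
    exact ⟨_, exp_mem hR hF, h.mono fun n hn => by simp only [hn]⟩
  | pow f α hα hf ih =>
    obtain ⟨F, hF, h⟩ := ih
    exact ⟨_, rpow_mem hR hF (hR.1.eventually_pos_of_tendsto hF h hf.tendsto_atTop_of_none)
      (const_mem R α), h.mono fun n hn => by simp only [hn]⟩
  | mul f g _ _ _ ihf ihg =>
    obtain ⟨F, hF, h⟩ := ihf
    obtain ⟨G, hG, k⟩ := ihg
    exact ⟨_, mul_mem hF hG, h.and k |>.mono fun n hn => by simp only [hn.1, hn.2, Pi.mul_apply]⟩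
  | div f g _ _ _ ihf ihg =>
    obtain ⟨F, hF, h⟩ := ihf
    obtain ⟨G, hG, k⟩ := ihg
    exact ⟨_, div_mem hR hF hG, h.and k |>.mono fun n hn => by simp only [hn.1, hn.2]⟩
  | expOmega f g _ h => exact h.elim
  | lnOmega f g _ h => exact h.elim
  | feedback f hf m q _ _ d d₀ t ht _ _ ih ihq =>
    obtain ⟨F, hF, h⟩ := ih
    choose Q hQ hq using ihq
    have hT : (∑ i, (fun _ => d i) * Q i) + (fun _ => d₀) ∈ R :=
      add_mem (sum_mem fun i _ => mul_mem (const_mem R _) (hQ i)) (const_mem R _)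
    refine ⟨_, rpow_mem hR hF (hR.1.eventually_pos_of_tendsto hF h hf.tendsto_atTop_of_none)
      (div_mem hR (const_mem R 1) hT), ?_⟩
    filter_upwards [h, eventually_all.2 hq] with n hn hqn
    simp [hn, ht, hqn]

/-- Positive members of a Hardy ring are comparable along the natural numbers, because the signs of
`F - c G` and `G - c F` are eventually constant for every real `c`. -/
theorem isLittleO_or_isTheta_or_isLittleO (hR : IsHardy R) {F G : ℝ → ℝ} (hF : F ∈ R) (hG : G ∈ R)
    (hF0 : ∀ᶠ x in atTop, 0 < F x) (hG0 : ∀ᶠ x in atTop, 0 < G x) :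
    F =o[atTop] G ∨ F =Θ[atTop] G ∨ G =o[atTop] F := by
  have key : ∀ {F G : ℝ → ℝ}, F ∈ R → G ∈ R → (∀ᶠ x in atTop, 0 < F x) →
      (∀ᶠ x in atTop, 0 < G x) → ¬ F =o[atTop] G → G =O[atTop] F := by
    intro F G hF hG hF0 hG0 h
    rw [isLittleO_iff] at h
    push Not at h
    obtain ⟨c, hc, h⟩ := h
    have hs : ∀ᶠ x in atTop, 0 ≤ F x - c * G x := by
      rcases hR.sign _ (sub_mem hF (mul_mem (const_mem R c) hG)) with k | k | k
      · exact k.mono fun x hx => hx.ge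
      · exact k.mono fun x hx => hx.le
      · refine absurd h (not_frequently.2 ?_)
        filter_upwards [k, hF0, hG0] with x hx h1 h2
        rw [Real.norm_of_nonneg h1.le, Real.norm_of_nonneg h2.le]
        simp only [Pi.sub_apply, Pi.mul_apply] at hx
        linarith
    refine IsBigO.of_bound c⁻¹ ?_
    filter_upwards [hs, hF0, hG0] with x hx h1 h2
    rw [Real.norm_of_nonneg h1.le, Real.norm_of_nonneg h2.le, inv_mul_eq_div, le_div_iff₀ hc]
    linarith
  by_cases h : F =o[atTop] G
  · exact .inl h
  by_cases k : G =o[atTop] F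
  · exact .inr (.inr k)
  · exact .inr (.inl ⟨key hG hF hG0 hF0 k, key hF hG hF0 hG0 h⟩)

end IsHardy

/-- Without the cardinal jump rule, comparability is Hardy's theorem on
logarithmico-exponential functions. -/
theorem CardinalJump.lawful_none : CardinalJump.none.Lawful where
  expOmega_infinite _ _ _ h := h.elim
  expOmega_large _ _ _ h := h.elim
  lnOmega_infinite _ _ _ h := h.elim
  lnOmega_small _ _ _ h := h.elim
  ordered f g hf hg := by
    obtain ⟨R, hR⟩ := IsHardy.exists_maximal
    obtain ⟨F, hF, h⟩ := IsHardy.exists_mem_of_infProto hR hf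
    obtain ⟨G, hG, k⟩ := IsHardy.exists_mem_of_infProto hR hg
    have ht : Tendsto (fun n : ℕ => (n : ℝ)) atTop atTop := tendsto_natCast_atTop_atTop
    have hf' : f =Θ[atTop] (F ∘ fun n : ℕ => (n : ℝ)) :=
      ⟨EventuallyEq.isBigO h, (EventuallyEq.symm h).isBigO⟩
    have hg' : g =Θ[atTop] (G ∘ fun n : ℕ => (n : ℝ)) :=
      ⟨EventuallyEq.isBigO k, (EventuallyEq.symm k).isBigO⟩
    rw [hf'.isLittleO_congr_left, hg'.isLittleO_congr_right, hf'.isLittleO_congr_right,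
      hg'.isLittleO_congr_left, hf'.isTheta_congr_left, hg'.isTheta_congr_right]
    exact (hR.1.isLittleO_or_isTheta_or_isLittleO hF hG
      (hR.1.eventually_pos_of_tendsto hF h hf.tendsto_atTop_of_none)
      (hR.1.eventually_pos_of_tendsto hG k hg.tendsto_atTop_of_none)).imp
      (fun h => h.comp_tendsto ht) (Or.imp (fun h => ⟨h.1.comp_tendsto ht, h.2.comp_tendsto ht⟩)
        fun h => h.comp_tendsto ht)

/-! ### The ordered group of prototype classes -/

namespace ArchClass

theorem Contains.mul {C D : ArchClass} {f g : RSeq} (hf : C.Contains f) (hg : D.Contains g) :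
    (C * D).Contains fun n => f n * g n := by
  obtain ⟨hf, rfl⟩ := hf
  obtain ⟨hg, rfl⟩ := hg
  exact ⟨by filter_upwards [hf, hg] with n h k using mul_ne_zero h k, rfl⟩

theorem Contains.inv {C : ArchClass} {f : RSeq} (hf : C.Contains f) :
    C⁻¹.Contains fun n => (f n)⁻¹ := by
  obtain ⟨hf, rfl⟩ := hf
  exact ⟨by filter_upwards [hf] with n h using inv_ne_zero h, rfl⟩

theorem contains_one : (1 : ArchClass).Contains fun _ => 1 :=
  ⟨.of_forall fun _ => one_ne_zero, rfl⟩

theorem Contains.eq_of_isTheta {C D : ArchClass} {f g : RSeq} (hf : C.Contains f)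
    (hg : D.Contains g) (h : f =Θ[atTop] g) : C = D := by
  obtain ⟨hf, rfl⟩ := hf
  obtain ⟨hg, rfl⟩ := hg
  exact Quotient.sound h

theorem Contains.smaller_iff {C D : ArchClass} {f g : RSeq} (hf : C.Contains f)
    (hg : D.Contains g) : C.Smaller D ↔ f =o[atTop] g := by
  obtain ⟨hf, rfl⟩ := hf
  obtain ⟨hg, rfl⟩ := hg
  rfl

theorem exists_contains (C : ArchClass) : ∃ f, C.Contains f := by
  induction C using Quotient.inductionOn with
  | h f => exact ⟨f.1, f.2, rfl⟩

theorem Smaller.trans {C D E : ArchClass} (h : C.Smaller D) (k : D.Smaller E) : C.Smaller E := by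
  obtain ⟨f, hf⟩ := C.exists_contains
  obtain ⟨g, hg⟩ := D.exists_contains
  obtain ⟨e, he⟩ := E.exists_contains
  rw [hf.smaller_iff hg] at h
  rw [hg.smaller_iff he] at k
  exact (hf.smaller_iff he).2 (h.trans k)

theorem Smaller.irrefl (C : ArchClass) : ¬ C.Smaller C := by
  obtain ⟨f, hf⟩ := C.exists_contains
  rw [hf.smaller_iff hf]
  exact isLittleO_irrefl hf.1.frequently

theorem Smaller.mul_left {C D : ArchClass} (h : C.Smaller D) (E : ArchClass) :
    (E * C).Smaller (E * D) := by
  obtain ⟨f, hf⟩ := C.exists_contains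
  obtain ⟨g, hg⟩ := D.exists_contains
  obtain ⟨e, he⟩ := E.exists_contains
  rw [hf.smaller_iff hg] at h
  exact ((he.mul hf).smaller_iff (he.mul hg)).2 ((isBigO_refl e _).mul_isLittleO h)

end ArchClass

open ArchClass

/-- The Archimedean classes of infinite prototypes. -/
def infClasses (J : CardinalJump) : Set ArchClass := {C | ∃ p, InfProto J p ∧ C.Contains p}

theorem mem_protoClasses_iff {J : CardinalJump} {C : ArchClass} :
    C ∈ protoClasses J ↔ C ∈ infClasses J ∨ C⁻¹ ∈ infClasses J ∨ C = 1 := by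
  constructor
  · rintro ⟨p, hp | ⟨f, hf, rfl⟩ | rfl, hC⟩
    · exact .inl ⟨p, hp, hC⟩
    · exact .inr (.inl ⟨f, hf, by simpa using hC.inv⟩)
    · exact .inr (.inr (hC.eq_of_isTheta contains_one (isTheta_refl _ _)))
  · rintro (⟨p, hp, hC⟩ | ⟨p, hp, hC⟩ | rfl)
    · exact ⟨p, .inl hp, hC⟩
    · exact ⟨_, .inr (.inl ⟨p, hp, rfl⟩), by simpa using hC.inv⟩
    · exact ⟨_, .inr (.inr rfl), contains_one⟩

section Group

variable {J : CardinalJump}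

/-- If two infinite prototypes have the same class, their product is not one by the product rule,
but its class contains the square of the first, which is an infinite prototype. -/
theorem mul_mem_infClasses {C D : ArchClass} (hC : C ∈ infClasses J) (hD : D ∈ infClasses J) :
    C * D ∈ infClasses J := by
  obtain ⟨p, hp, hC⟩ := hC
  obtain ⟨q, hq, hD⟩ := hD
  by_cases h : p =Θ[atTop] q
  · obtain rfl := hC.eq_of_isTheta hD h
    refine ⟨_, hp.pow _ 2 two_pos, ?_⟩
    simpa only [Real.rpow_two, sq] using hC.mul hC
  · exact ⟨_, hp.mul _ _ hq h, hC.mul hD⟩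

theorem one_smaller_of_mem_infClasses (hJ : J.Lawful) {C : ArchClass} (hC : C ∈ infClasses J) :
    (1 : ArchClass).Smaller C := by
  obtain ⟨p, hp, hC⟩ := hC
  rw [contains_one.smaller_iff hC, isLittleO_const_left]
  exact .inr (tendsto_norm_atTop_atTop.comp (hp.tendsto_atTop_of_lawful hJ))

theorem div_mem_protoClasses (hJ : J.Lawful) {C D : ArchClass} (hC : C ∈ infClasses J)
    (hD : D ∈ infClasses J) : C * D⁻¹ ∈ protoClasses J := by
  rw [mem_protoClasses_iff]
  obtain ⟨p, hp, hC⟩ := hC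
  obtain ⟨q, hq, hD⟩ := hD
  rcases hJ.ordered p q hp hq with h | h | h
  · exact .inr (.inl ⟨_, hq.div _ _ hp h, by
      simpa only [mul_inv_rev, inv_inv, div_eq_mul_inv] using hD.mul hC.inv⟩)
  · exact .inr (.inr (by rw [hC.eq_of_isTheta hD h, mul_inv_cancel]))
  · exact .inl ⟨_, hp.div _ _ hq h, hC.mul hD.inv⟩

theorem inv_mem_protoClasses {C : ArchClass} (hC : C ∈ protoClasses J) :
    C⁻¹ ∈ protoClasses J := by
  rw [mem_protoClasses_iff] at hC ⊢
  rw [inv_inv, inv_eq_one]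
  tauto

theorem mul_mem_protoClasses (hJ : J.Lawful) {C D : ArchClass} (hC : C ∈ protoClasses J)
    (hD : D ∈ protoClasses J) : C * D ∈ protoClasses J := by
  rcases mem_protoClasses_iff.1 hC with hC' | hC' | rfl
  · rcases mem_protoClasses_iff.1 hD with hD' | hD' | rfl
    · exact mem_protoClasses_iff.2 (.inl (mul_mem_infClasses hC' hD'))
    · simpa using div_mem_protoClasses hJ hC' hD'
    · rwa [mul_one]
  · rcases mem_protoClasses_iff.1 hD with hD' | hD' | rfl
    · simpa [mul_comm] using div_mem_protoClasses hJ hD' hC'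
    · exact mem_protoClasses_iff.2 (.inr (.inl (by
        simpa [mul_comm] using mul_mem_infClasses hC' hD')))
    · rwa [mul_one]
  · rwa [one_mul]

end Group

section ProtoGroup

variable (J : CardinalJump) [hJ : Fact J.Lawful]

/-- The group of the Archimedean classes that have a prototype. -/
def protoGroup : Subgroup ArchClass where
  carrier := protoClasses J
  mul_mem' := mul_mem_protoClasses hJ.out
  one_mem' := mem_protoClasses_iff.2 (.inr (.inr rfl))
  inv_mem' := inv_mem_protoClasses

theorem protoGroup_trichotomy (C D : protoGroup J) :
    C.1.Smaller D ∨ C = D ∨ D.1.Smaller C := by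
  rcases mem_protoClasses_iff.1 (C⁻¹ * D).2 with h | h | h
  · left; simpa using (one_smaller_of_mem_infClasses hJ.out h).mul_left C
  · right; right; simpa using (one_smaller_of_mem_infClasses hJ.out h).mul_left D
  · right; left; exact inv_mul_eq_one.1 (Subtype.ext h)

/-- The reverse of the order by size: larger classes come first, as in the exponents of
Hahn series. -/
noncomputable instance : LinearOrder (protoGroup J) where
  le C D := C = D ∨ D.1.Smaller C
  lt C D := D.1.Smaller C
  le_refl C := .inl rfl
  le_trans C D E h k := by
    rcases h with rfl | h
    · exact k
    · rcases k with rfl | k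
      · exact .inr h
      · exact .inr (k.trans h)
  lt_iff_le_not_ge C D := by
    refine ⟨fun h => ⟨.inr h, ?_⟩, fun ⟨h, k⟩ => h.resolve_left fun e => k (.inl e.symm)⟩
    rintro (rfl | k)
    · exact Smaller.irrefl _ h
    · exact Smaller.irrefl _ (h.trans k)
  le_antisymm C D h k := by
    rcases h with rfl | h
    · rfl
    · exact k.elim Eq.symm fun k => (Smaller.irrefl _ (h.trans k)).elim
  le_total C D := by
    rcases protoGroup_trichotomy J C D with h | rfl | h
    · exact .inr (.inr h)
    · exact .inl (.inl rfl)
    · exact .inl (.inr h)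
  toDecidableLE := Classical.decRel _

instance : IsOrderedMonoid (protoGroup J) where
  mul_le_mul_left C D h E := by
    rcases h with rfl | h
    · exact le_rfl
    · exact .inr (by simpa [mul_comm] using h.mul_left E.1)

end ProtoGroup

section Limits

variable (J : CardinalJump) [hJ : Fact J.Lawful]

/-! ### Limits of smooth sequences -/

/-- The inclusion of the formal sums over classes that have prototypes into all formal sums. -/
noncomputable def protoIncl : MonoidAlgebra ℝ (protoGroup J) →+* FormalSum :=
  MonoidAlgebra.mapDomainRingHom ℝ (protoGroup J).subtype

theorem protoIncl_injective : Function.Injective (protoIncl J) :=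
  MonoidAlgebra.mapDomain_injective Subtype.val_injective

theorem protoIncl_single (C : protoGroup J) (c : ℝ) :
    protoIncl J (MonoidAlgebra.single C c) = MonoidAlgebra.single C.1 c :=
  MonoidAlgebra.mapDomain_single

theorem coeff_protoIncl (u : MonoidAlgebra ℝ (protoGroup J)) (C : protoGroup J) :
    (protoIncl J u).coeff C.1 = u.coeff C :=
  Finsupp.mapDomain_apply Subtype.val_injective _ _

theorem coeff_protoIncl_of_notMem (u : MonoidAlgebra ℝ (protoGroup J)) {C : ArchClass}
    (hC : C ∉ protoGroup J) : (protoIncl J u).coeff C = 0 :=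
  Finsupp.mapDomain_of_notMem_range _ _ fun ⟨D, h⟩ => hC (h ▸ D.2)

/-- The sequence that is the given linear combination of typical members. -/
noncomputable def combination (rep : ArchClass → RSeq) (u : MonoidAlgebra ℝ (protoGroup J)) :
    RSeq := fun n => u.coeff.sum fun C c => c * rep C n

theorem combination_erase (rep : ArchClass → RSeq) (u : MonoidAlgebra ℝ (protoGroup J))
    (C : protoGroup J) :
    (fun n => combination J rep u n - u.coeff C * rep C n) = combination J rep (u.erase C) := by
  funext n
  have h : combination J rep u n
      = u.coeff C * rep C n + combination J rep (u.erase C) n := by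
    conv_lhs => rw [← MonoidAlgebra.single_add_erase C u]
    simp only [combination, MonoidAlgebra.coeff_add, MonoidAlgebra.coeff_single]
    rw [Finsupp.sum_add_index' (fun _ => zero_mul _) (fun _ _ _ => add_mul _ _ _),
      Finsupp.sum_single_index (zero_mul _)]
  rw [h, add_sub_cancel_left]

variable {J} {rep : ArchClass → RSeq} (hrep : IsTypicalChoice J rep)
include hrep

/-- A nonzero combination of typical members has as its leading term that of the largest class,
which is the least one in the order of `protoGroup J`. -/
theorem exists_leadingTerm_combination {u : MonoidAlgebra ℝ (protoGroup J)} (hu : u ≠ 0) :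
    ∃ C ∈ u.coeff.support, LeadingTerm J rep (combination J rep u) (u.coeff C) C.1 := by
  have hne : u.coeff.support.Nonempty := by
    rw [Finsupp.support_nonempty_iff]
    exact fun h => hu (MonoidAlgebra.coeff_eq_zero.1 h)
  set C := u.coeff.support.min' hne with hC
  have hmem : C ∈ u.coeff.support := Finset.min'_mem _ _
  refine ⟨C, hmem, Finsupp.mem_support_iff.1 hmem, C.2, ?_⟩
  have h0 : ∀ᶠ n in atTop, rep C n ≠ 0 := (hrep C C.2).2.1
  have hterm : ∀ D ∈ u.coeff.support, Tendsto (fun n => u.coeff D * rep D n / rep C n) atTop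
      (𝓝 (if D = C then u.coeff C else 0)) := by
    intro D hD
    split_ifs with h
    · subst h
      refine tendsto_const_nhds.congr' ?_
      filter_upwards [h0] with n hn using (mul_div_cancel_right₀ _ hn).symm
    · have hlt : C < D := lt_of_le_of_ne (Finset.min'_le _ _ hD) (Ne.symm h)
      have ho := ((hrep D D.2).2.smaller_iff (hrep C C.2).2).1 hlt
      simpa [mul_div_assoc] using ho.tendsto_div_nhds_zero.const_mul (u.coeff D)
  have := tendsto_finsetSum _ hterm
  rw [Finset.sum_ite_eq' , if_pos hmem] at this
  refine this.congr fun n => ?_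
  rw [← Finset.sum_div]
  rfl

theorem smooth_combination (u : MonoidAlgebra ℝ (protoGroup J)) :
    Smooth J rep (combination J rep u) := by
  -- The set of all combinations is closed under the subtraction of leading terms.
  refine ⟨Set.range (combination J rep), ⟨u, rfl⟩, ?_⟩
  rintro _ ⟨u, rfl⟩
  by_cases hu : u = 0
  · left; simp [hu, combination]
  · obtain ⟨C, -, h⟩ := exists_leadingTerm_combination hrep hu
    exact .inr ⟨_, _, h, _, (combination_erase J rep u C).symm⟩

/-- By induction on the number of terms: subtracting the leading term of a combination removes it
from the formal sum. -/
theorem hasLimit_combination (n : ℕ) : ∀ u : MonoidAlgebra ℝ (protoGroup J),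
    u.coeff.support.card = n → HasLimit J rep (combination J rep u) (protoIncl J u) := by
  induction n with
  | zero =>
    intro u hu
    have : u = 0 := by
      rw [Finset.card_eq_zero, Finsupp.support_eq_empty] at hu
      exact MonoidAlgebra.coeff_eq_zero.1 hu
    subst this
    rw [map_zero]
    exact .zero _ (by simp [combination])
  | succ n ih =>
    intro u hu
    have hu0 : u ≠ 0 := by rintro rfl; simp at hu
    obtain ⟨C, hC, h⟩ := exists_leadingTerm_combination hrep hu0
    have hcard : (u.erase C).coeff.support.card = n := by
      rw [MonoidAlgebra.coeff_erase, Finsupp.support_erase, Finset.card_erase_of_mem hC, hu]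
      rfl
    have := HasLimit.next _ _ _ h (protoIncl J (u.erase C)) (by
      rw [combination_erase]; exact ih _ hcard)
    rwa [← protoIncl_single, ← map_add, MonoidAlgebra.single_add_erase] at this

/-- The limits of smooth sequences are all formal sums over classes that have prototypes. -/
theorem isSmoothLimit_iff {L : FormalSum} :
    IsSmoothLimit J rep L ↔ L ∈ (protoIncl J).range := by
  constructor
  · rintro ⟨s, -, h⟩
    induction h with
    | zero => exact zero_mem _
    | last s c C h => exact ⟨.single ⟨C, h.2.1⟩ c, protoIncl_single ..⟩
    | next s c C h L _ ih => exact add_mem ⟨.single ⟨C, h.2.1⟩ c, protoIncl_single ..⟩ ih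
  · rintro ⟨u, rfl⟩
    exact ⟨_, smooth_combination hrep u, hasLimit_combination hrep _ u rfl⟩

omit hrep

/-! ### The embedding into Hahn series -/


section Hahn

variable {G : Type*} [CommGroup G] [LinearOrder G] [IsOrderedMonoid G]

-- A shortcut for instance search, which is slow on the exponent group `Additive G`.
noncomputable instance : Algebra ℝ (HahnSeries (Additive G) ℝ) := HahnSeries.instAlgebra

/-- A formal sum over an ordered group, as a Hahn series of finite support. -/
noncomputable def MonoidAlgebra.toHahnSeries :
    MonoidAlgebra ℝ G →ₐ[ℝ] HahnSeries (Additive G) ℝ :=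
  MonoidAlgebra.lift ℝ _ _
    { toFun C := HahnSeries.single (Additive.ofMul C) (1 : ℝ)
      map_one' := rfl
      map_mul' C D := by rw [ofMul_mul, HahnSeries.single_mul_single, one_mul] }

theorem MonoidAlgebra.coeff_toHahnSeries (u : MonoidAlgebra ℝ G) (C : G) :
    (toHahnSeries u).coeff (Additive.ofMul C) = u.coeff C := by
  induction u using MonoidAlgebra.induction_linear with
  | zero => simp
  | add u v hu hv => simp [hu, hv]
  | single D c =>
    rw [toHahnSeries, MonoidAlgebra.lift_single, HahnSeries.coeff_smul, MonoidAlgebra.coeff_single]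
    by_cases h : D = C
    · subst h; simp
    · have : Additive.ofMul C ≠ Additive.ofMul D := fun e => h (Additive.ofMul.injective e).symm
      simp [HahnSeries.coeff_single_of_ne this, Finsupp.single_eq_of_ne (Ne.symm h)]

end Hahn

variable (J)

/-- The ordered field of Hahn series with real coefficients whose exponents are the classes that
have prototypes, larger classes coming first. -/
abbrev HahnField : Type := Lex (HahnSeries (Additive (protoGroup J)) ℝ)

/-- A formal sum over classes that have prototypes, as a Hahn series. -/
noncomputable def toHahn : MonoidAlgebra ℝ (protoGroup J) →+* HahnField J :=
  (MonoidAlgebra.toHahnSeries (G := protoGroup J)).toRingHom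

theorem coeff_toHahn (u : MonoidAlgebra ℝ (protoGroup J)) (C : protoGroup J) :
    (ofLex (toHahn J u)).coeff (Additive.ofMul C) = u.coeff C :=
  MonoidAlgebra.coeff_toHahnSeries u C

theorem toHahn_injective : Function.Injective (toHahn J) := by
  intro u v h
  apply MonoidAlgebra.coeff_injective
  ext C
  rw [← coeff_toHahn, h, coeff_toHahn]

/-- The order of limits is the order of Hahn series. -/
theorem limitLT_iff (u v : MonoidAlgebra ℝ (protoGroup J)) :
    LimitLT (protoIncl J u) (protoIncl J v) ↔ toHahn J u < toHahn J v := by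
  rw [HahnSeries.lt_iff]
  constructor
  · rintro ⟨C, h, hC⟩
    by_cases hm : C ∈ protoGroup J
    · lift C to protoGroup J using hm
      refine ⟨Additive.ofMul C, fun D hD => ?_, ?_⟩
      · have := hC D.toMul.1 hD
        rw [coeff_protoIncl, coeff_protoIncl] at this
        rwa [← ofMul_toMul D, coeff_toHahn, coeff_toHahn]
      · rwa [coeff_toHahn, coeff_toHahn, ← coeff_protoIncl, ← coeff_protoIncl]
    · rw [coeff_protoIncl_of_notMem J u hm, coeff_protoIncl_of_notMem J v hm] at h
      exact (lt_irrefl _ h).elim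
  · rintro ⟨C, hC, h⟩
    refine ⟨C.toMul.1, ?_, fun D hD => ?_⟩
    · rwa [coeff_protoIncl, coeff_protoIncl, ← coeff_toHahn, ← coeff_toHahn]
    · by_cases hm : D ∈ protoGroup J
      · lift D to protoGroup J using hm
        have := hC (Additive.ofMul D) hD
        rwa [coeff_protoIncl, coeff_protoIncl, ← coeff_toHahn, ← coeff_toHahn]
      · rw [coeff_protoIncl_of_notMem J u hm, coeff_protoIncl_of_notMem J v hm]

/-- The Hahn series of a formal sum, provided that its classes have prototypes; terms of other
classes are dropped. -/
noncomputable def hahn (L : FormalSum) : HahnField J :=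
  toHahn J (L.comapDomain Subtype.val Subtype.val_injective)

theorem hahn_protoIncl (u : MonoidAlgebra ℝ (protoGroup J)) :
    hahn J (protoIncl J u) = toHahn J u := by
  refine congrArg (toHahn J) ?_
  apply MonoidAlgebra.coeff_injective
  ext C
  rw [MonoidAlgebra.coeff_comapDomain, Finsupp.comapDomain_apply, coeff_protoIncl]

end Limits

/-! ### The ordered field of quotients -/

section Quotients

variable {J : CardinalJump} [hJ : Fact J.Lawful] {rep : ArchClass → RSeq}

/-- The value of a quotient in the field of Hahn series. -/
noncomputable def LimitQuotient.toHahn (a : LimitQuotient J rep) : HahnField J :=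
  hahn J a.num / hahn J a.den

variable (hrep : IsTypicalChoice J rep)
include hrep

theorem hahn_add {x y : FormalSum} (hx : IsSmoothLimit J rep x) (hy : IsSmoothLimit J rep y) :
    hahn J (x + y) = hahn J x + hahn J y := by
  obtain ⟨u, rfl⟩ := (isSmoothLimit_iff hrep).1 hx
  obtain ⟨v, rfl⟩ := (isSmoothLimit_iff hrep).1 hy
  rw [← map_add, hahn_protoIncl, hahn_protoIncl, hahn_protoIncl, map_add]

theorem hahn_mul {x y : FormalSum} (hx : IsSmoothLimit J rep x) (hy : IsSmoothLimit J rep y) :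
    hahn J (x * y) = hahn J x * hahn J y := by
  obtain ⟨u, rfl⟩ := (isSmoothLimit_iff hrep).1 hx
  obtain ⟨v, rfl⟩ := (isSmoothLimit_iff hrep).1 hy
  rw [← map_mul, hahn_protoIncl, hahn_protoIncl, hahn_protoIncl, map_mul]

theorem hahn_neg {x : FormalSum} (hx : IsSmoothLimit J rep x) : hahn J (-x) = -hahn J x := by
  obtain ⟨u, rfl⟩ := (isSmoothLimit_iff hrep).1 hx
  rw [← map_neg, hahn_protoIncl, hahn_protoIncl, map_neg]

omit hrep in
theorem hahn_zero : hahn J 0 = 0 := by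
  rw [← map_zero (protoIncl J), hahn_protoIncl, map_zero]

omit hrep in
theorem hahn_one : hahn J 1 = 1 := by
  rw [← map_one (protoIncl J), hahn_protoIncl, map_one]

theorem hahn_inj {x y : FormalSum} (hx : IsSmoothLimit J rep x) (hy : IsSmoothLimit J rep y) :
    hahn J x = hahn J y ↔ x = y := by
  obtain ⟨u, rfl⟩ := (isSmoothLimit_iff hrep).1 hx
  obtain ⟨v, rfl⟩ := (isSmoothLimit_iff hrep).1 hy
  rw [hahn_protoIncl, hahn_protoIncl, (toHahn_injective J).eq_iff, (protoIncl_injective J).eq_iff]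

theorem hahn_lt {x y : FormalSum} (hx : IsSmoothLimit J rep x) (hy : IsSmoothLimit J rep y) :
    hahn J x < hahn J y ↔ LimitLT x y := by
  obtain ⟨u, rfl⟩ := (isSmoothLimit_iff hrep).1 hx
  obtain ⟨v, rfl⟩ := (isSmoothLimit_iff hrep).1 hy
  rw [hahn_protoIncl, hahn_protoIncl, limitLT_iff]

theorem isSmoothLimit_zero : IsSmoothLimit J rep 0 := (isSmoothLimit_iff hrep).2 (zero_mem _)

theorem isSmoothLimit_one : IsSmoothLimit J rep 1 := (isSmoothLimit_iff hrep).2 (one_mem _)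

theorem IsSmoothLimit.add {x y : FormalSum} (hx : IsSmoothLimit J rep x)
    (hy : IsSmoothLimit J rep y) : IsSmoothLimit J rep (x + y) := by
  rw [isSmoothLimit_iff hrep] at *; exact add_mem hx hy

theorem IsSmoothLimit.mul {x y : FormalSum} (hx : IsSmoothLimit J rep x)
    (hy : IsSmoothLimit J rep y) : IsSmoothLimit J rep (x * y) := by
  rw [isSmoothLimit_iff hrep] at *; exact mul_mem hx hy

theorem IsSmoothLimit.neg {x : FormalSum} (hx : IsSmoothLimit J rep x) :
    IsSmoothLimit J rep (-x) := by
  rw [isSmoothLimit_iff hrep] at *; exact neg_mem hx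

theorem hahn_ne_zero {x : FormalSum} (hx : IsSmoothLimit J rep x) (h : x ≠ 0) : hahn J x ≠ 0 := by
  rwa [← hahn_zero, Ne, hahn_inj hrep hx (isSmoothLimit_zero hrep)]

theorem IsSmoothLimit.mul_ne_zero {x y : FormalSum} (hx : IsSmoothLimit J rep x)
    (hy : IsSmoothLimit J rep y) (hx0 : x ≠ 0) (hy0 : y ≠ 0) : x * y ≠ 0 := by
  intro h
  have := hahn_mul hrep hx hy
  rw [h, hahn_zero] at this
  exact (_root_.mul_ne_zero (hahn_ne_zero hrep hx hx0) (hahn_ne_zero hrep hy hy0)) this.symm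

namespace LimitQuotient

theorem hahn_den_ne_zero (a : LimitQuotient J rep) : hahn J a.den ≠ 0 :=
  hahn_ne_zero hrep a.den_isSmoothLimit a.den_ne_zero

theorem toHahn_eq_iff (a b : LimitQuotient J rep) :
    a.toHahn = b.toHahn ↔ a.num * b.den = b.num * a.den := by
  rw [toHahn, toHahn, div_eq_div_iff (a.hahn_den_ne_zero hrep) (b.hahn_den_ne_zero hrep),
    ← hahn_mul hrep a.num_isSmoothLimit b.den_isSmoothLimit,
    ← hahn_mul hrep b.num_isSmoothLimit a.den_isSmoothLimit,
    hahn_inj hrep (a.num_isSmoothLimit.mul hrep b.den_isSmoothLimit)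
      (b.num_isSmoothLimit.mul hrep a.den_isSmoothLimit)]

theorem toHahn_lt_iff {a b : LimitQuotient J rep} (ha : LimitLT 0 a.den) (hb : LimitLT 0 b.den) :
    a.toHahn < b.toHahn ↔ LimitLT (a.num * b.den) (b.num * a.den) := by
  rw [← hahn_lt hrep (isSmoothLimit_zero hrep) a.den_isSmoothLimit, hahn_zero] at ha
  rw [← hahn_lt hrep (isSmoothLimit_zero hrep) b.den_isSmoothLimit, hahn_zero] at hb
  rw [toHahn, toHahn, div_lt_div_iff₀ ha hb,
    ← hahn_mul hrep a.num_isSmoothLimit b.den_isSmoothLimit,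
    ← hahn_mul hrep b.num_isSmoothLimit a.den_isSmoothLimit,
    hahn_lt hrep (a.num_isSmoothLimit.mul hrep b.den_isSmoothLimit)
      (b.num_isSmoothLimit.mul hrep a.den_isSmoothLimit)]

theorem exists_add (a b : LimitQuotient J rep) : ∃ c : LimitQuotient J rep,
    c.num = a.num * b.den + b.num * a.den ∧ c.den = a.den * b.den ∧
      c.toHahn = a.toHahn + b.toHahn := by
  have h1 := a.num_isSmoothLimit.mul hrep b.den_isSmoothLimit
  have h2 := b.num_isSmoothLimit.mul hrep a.den_isSmoothLimit
  refine ⟨⟨_, _, h1.add hrep h2, a.den_isSmoothLimit.mul hrep b.den_isSmoothLimit,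
    a.den_isSmoothLimit.mul_ne_zero hrep b.den_isSmoothLimit a.den_ne_zero b.den_ne_zero⟩,
    rfl, rfl, ?_⟩
  simp only [toHahn]
  rw [hahn_add hrep h1 h2, hahn_mul hrep a.num_isSmoothLimit b.den_isSmoothLimit,
    hahn_mul hrep b.num_isSmoothLimit a.den_isSmoothLimit,
    hahn_mul hrep a.den_isSmoothLimit b.den_isSmoothLimit,
    div_add_div _ _ (a.hahn_den_ne_zero hrep) (b.hahn_den_ne_zero hrep),
    mul_comm (hahn J b.num)]

theorem exists_mul (a b : LimitQuotient J rep) : ∃ c : LimitQuotient J rep,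
    c.num = a.num * b.num ∧ c.den = a.den * b.den ∧ c.toHahn = a.toHahn * b.toHahn := by
  refine ⟨⟨_, _, a.num_isSmoothLimit.mul hrep b.num_isSmoothLimit,
    a.den_isSmoothLimit.mul hrep b.den_isSmoothLimit,
    a.den_isSmoothLimit.mul_ne_zero hrep b.den_isSmoothLimit a.den_ne_zero b.den_ne_zero⟩,
    rfl, rfl, ?_⟩
  simp only [toHahn]
  rw [hahn_mul hrep a.num_isSmoothLimit b.num_isSmoothLimit,
    hahn_mul hrep a.den_isSmoothLimit b.den_isSmoothLimit, div_mul_div_comm]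

theorem exists_neg (a : LimitQuotient J rep) :
    ∃ c : LimitQuotient J rep, c.toHahn = -a.toHahn := by
  refine ⟨⟨-a.num, a.den, a.num_isSmoothLimit.neg hrep, a.den_isSmoothLimit, a.den_ne_zero⟩, ?_⟩
  simp only [toHahn]
  rw [hahn_neg hrep a.num_isSmoothLimit]
  exact neg_div (hahn J a.den) (hahn J a.num)

/-- If the denominator is negative, both parts of the quotient are negated. -/
theorem exists_den_pos (a : LimitQuotient J rep) :
    ∃ b : LimitQuotient J rep, b.value = a.value ∧ LimitLT 0 b.den := by
  rcases lt_or_gt_of_ne (a.hahn_den_ne_zero hrep) with h | h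
  · refine ⟨⟨-a.num, -a.den, a.num_isSmoothLimit.neg hrep, a.den_isSmoothLimit.neg hrep,
      neg_ne_zero.2 a.den_ne_zero⟩, Quot.sound (by simp only [neg_mul, mul_neg]), ?_⟩
    rw [← hahn_lt hrep (isSmoothLimit_zero hrep) (a.den_isSmoothLimit.neg hrep), hahn_zero,
      hahn_neg hrep a.den_isSmoothLimit]
    exact neg_pos.2 h
  · refine ⟨a, rfl, ?_⟩
    rwa [← hahn_lt hrep (isSmoothLimit_zero hrep) a.den_isSmoothLimit, hahn_zero]

end LimitQuotient

/-- The quotients of limits of smooth sequences, as a subfield of the field of Hahn series. -/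
noncomputable def quotientField : Subfield (HahnField J) where
  carrier := Set.range (LimitQuotient.toHahn (J := J) (rep := rep))
  zero_mem' := ⟨⟨0, 1, isSmoothLimit_zero hrep, isSmoothLimit_one hrep, one_ne_zero⟩, by
    rw [LimitQuotient.toHahn, hahn_zero, zero_div]⟩
  one_mem' := ⟨⟨1, 1, isSmoothLimit_one hrep, isSmoothLimit_one hrep, one_ne_zero⟩, by
    rw [LimitQuotient.toHahn, hahn_one, div_one]⟩
  add_mem' := by
    rintro _ _ ⟨a, rfl⟩ ⟨b, rfl⟩
    obtain ⟨c, -, -, h⟩ := a.exists_add hrep b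
    exact ⟨c, h⟩
  mul_mem' := by
    rintro _ _ ⟨a, rfl⟩ ⟨b, rfl⟩
    obtain ⟨c, -, -, h⟩ := a.exists_mul hrep b
    exact ⟨c, h⟩
  neg_mem' := by
    rintro _ ⟨a, rfl⟩
    exact a.exists_neg hrep
  inv_mem' := by
    rintro _ ⟨a, rfl⟩
    -- The number `0` is its own inverse in a subfield.
    by_cases h : a.num = 0
    · exact ⟨a, by rw [LimitQuotient.toHahn, h, hahn_zero, zero_div, inv_zero]⟩
    · exact ⟨⟨a.den, a.num, a.den_isSmoothLimit, a.num_isSmoothLimit, h⟩, (inv_div _ _).symm⟩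

/-- The numbers `lim s / lim t` are the elements of a subfield of the field of Hahn series. -/
noncomputable def infiniteNumbersEquiv : InfiniteNumbers J rep ≃ quotientField hrep :=
  Equiv.ofBijective
    (Quot.lift (fun a => ⟨a.toHahn, a, rfl⟩)
      fun a b h => Subtype.ext ((a.toHahn_eq_iff hrep b).2 h)) <| by
    constructor
    · rintro ⟨a⟩ ⟨b⟩ h
      exact Quot.sound ((a.toHahn_eq_iff hrep b).1 (congrArg Subtype.val h))
    · rintro ⟨_, a, rfl⟩
      exact ⟨a.value, rfl⟩

end Quotients

theorem mainTheorem1 (J : CardinalJump) (hJ : J = CardinalJump.none ∨ J.Lawful)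
    (rep : ArchClass → RSeq) (hrep : IsTypicalChoice J rep) :
    (∀ a b : LimitQuotient J rep,
      a.value = b.value ↔ a.num * b.den = b.num * a.den) ∧
    (∀ x : InfiniteNumbers J rep,
      ∃ a : LimitQuotient J rep, a.value = x ∧ LimitLT 0 a.den) ∧
    ∃ (_ : Field (InfiniteNumbers J rep)) (_ : LinearOrder (InfiniteNumbers J rep)),
      IsStrictOrderedRing (InfiniteNumbers J rep) ∧
      (∀ a b : LimitQuotient J rep, ∃ c : LimitQuotient J rep,
        c.num = a.num * b.den + b.num * a.den ∧ c.den = a.den * b.den ∧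
        a.value + b.value = c.value) ∧
      (∀ a b : LimitQuotient J rep, ∃ c : LimitQuotient J rep,
        c.num = a.num * b.num ∧ c.den = a.den * b.den ∧
        a.value * b.value = c.value) ∧
      (∀ a b : LimitQuotient J rep, LimitLT 0 a.den → LimitLT 0 b.den →
        (a.value < b.value ↔ LimitLT (a.num * b.den) (b.num * a.den))) := by
  -- Either way the infinite prototypes are comparable.
  have hJ' : J.Lawful := hJ.elim (fun h => h ▸ CardinalJump.lawful_none) id
  have : Fact J.Lawful := ⟨hJ'⟩
  -- All the structure is carried over from the subfield of Hahn series.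
  let e := infiniteNumbersEquiv hrep
  let _ : Field (InfiniteNumbers J rep) := e.field
  let _ : LinearOrder (InfiniteNumbers J rep) := LinearOrder.lift' e e.injective
  have hadd : ∀ x y, e (x + y) = e x + e y := (e.ringEquiv).map_add
  have hmul : ∀ x y, e (x * y) = e x * e y := (e.ringEquiv).map_mul
  refine ⟨fun a b => ?_, ?_, inferInstance, inferInstance, ?_, fun a b => ?_, fun a b => ?_,
    fun a b ha hb => ?_⟩
  · exact ⟨fun h => (a.toHahn_eq_iff hrep b).1 (congrArg (fun x => (e x : HahnField J)) h),
      fun h => Quot.sound h⟩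
  · rintro ⟨a⟩
    exact a.exists_den_pos hrep
  · exact Function.Injective.isStrictOrderedRing e (e.ringEquiv).map_zero (e.ringEquiv).map_one
      hadd hmul Iff.rfl Iff.rfl
  · obtain ⟨c, hn, hd, h⟩ := a.exists_add hrep b
    refine ⟨c, hn, hd, e.injective (Subtype.ext ?_)⟩
    rw [hadd]
    exact h.symm
  · obtain ⟨c, hn, hd, h⟩ := a.exists_mul hrep b
    refine ⟨c, hn, hd, e.injective (Subtype.ext ?_)⟩
    rw [hmul]
    exact h.symm
  · exact a.toHahn_lt_iff hrep ha hb
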